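/- Let $n\ge 0$ be an integer and let $R$ be an $n$-Gorenstein ring, i.e. a (not necessarily commutative) left and right Noetherian ring with $\mathrm{id}({}_RR)\le n$ and $\mathrm{id}(R_R)\le n$. Here the injective dimension $\mathrm{id}(M)$ of a module $M$ is the least integer $k\ge 0$ such that $\mathrm{Ext}^j_R(-,M)=0$ for all $j>k$ ($\infty$ if there is none). Let $\mathrm{Flat}(R)$ be the class of flat left $R$-modules and assume that $$\mathrm{id}(\mathrm{Flat}(R)):=\sup\{\mathrm{id}(F): F\in\mathrm{Flat}(R)\}<\infty .$$ A left $R$-module is called Ding projective if it is isomorphic to a cycle of an exact complex $P_\bullet$ of projective left $R$-modules such that the complex $\mathrm{Hom}_R(P_\bullet,F)$ is exact for every $F\in\mathrm{Flat}(R)$. The Ding projective dimension of a left $R$-module $M$ is the least integer $k\ge 0$ for which there is an exact sequence $0\to G_k\to\cdots\to G_1\to G_0\to M\to 0$ with all $G_i$ Ding projective ($\infty$ if there is none), and the left global Ding projective dimension of $R$ is the supremum of the Ding projective dimensions of all left $R$-modules. Then the left global Ding projective dimension of $R$ is at most $n$, and it is equal to $\mathrm{id}({}_RR)$. -/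

import Mathlib

open CategoryTheory
open scoped TensorProduct

universe u v w

namespace DingDim

/-! ### Flat left modules over a ring that need not be commutative -/

section Flat

variable (R : Type u) [Ring R]

/-- The subgroup of `A ⊗[ℤ] M` (for `A` a right and `M` a left `R`-module) generated by the elements
`a r ⊗ m - a ⊗ r m`. -/
def balancedRel (A : Type u) [AddCommGroup A] [Module Rᵐᵒᵖ A] (M : Type u) [AddCommGroup M]
    [Module R M] : AddSubgroup (A ⊗[ℤ] M) :=
  AddSubgroup.closure
    {t | ∃ (a : A) (r : R) (m : M), t = (MulOpposite.op r • a) ⊗ₜ[ℤ] m - a ⊗ₜ[ℤ] (r • m)}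

/-- The tensor product `A ⊗_R M` of a right `R`-module `A` and a left `R`-module `M`, an abelian
group. -/
abbrev BalancedTensor (A : Type u) [AddCommGroup A] [Module Rᵐᵒᵖ A] (M : Type u) [AddCommGroup M]
    [Module R M] : Type u :=
  (A ⊗[ℤ] M) ⧸ balancedRel R A M

variable {R} in
/-- The map `f ⊗ id : A ⊗_R M → B ⊗_R M` induced by a morphism `f : A → B` of right modules. -/
def BalancedTensor.map {A B : Type u} [AddCommGroup A] [Module Rᵐᵒᵖ A] [AddCommGroup B]
    [Module Rᵐᵒᵖ B] (f : A →ₗ[Rᵐᵒᵖ] B) (M : Type u) [AddCommGroup M] [Module R M] :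
    BalancedTensor R A M →+ BalancedTensor R B M :=
  QuotientAddGroup.map _ _ (f.toAddMonoidHom.toIntLinearMap.rTensor M).toAddMonoidHom (by
    rw [balancedRel, AddSubgroup.closure_le]
    rintro _ ⟨a, r, m, rfl⟩
    refine AddSubgroup.subset_closure ⟨f a, r, m, ?_⟩
    simp)

/-- A left `R`-module `M` is flat if `- ⊗_R M` preserves injectivity of morphisms of right
`R`-modules, i.e. if the (right exact) functor `- ⊗_R M` is exact. -/
def IsFlat (M : Type u) [AddCommGroup M] [Module R M] : Prop :=
  ∀ ⦃A B : Type u⦄ [AddCommGroup A] [Module Rᵐᵒᵖ A] [AddCommGroup B] [Module Rᵐᵒᵖ B]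
    (f : A →ₗ[Rᵐᵒᵖ] B), Function.Injective f → Function.Injective (BalancedTensor.map f M)

/-- The class `Flat(R)` of all flat left `R`-modules. -/
def flatModules : ObjectProperty (ModuleCat.{u} R) := fun M => IsFlat R M

end Flat

/-! ### Homological dimensions in an abelian category -/

section Abelian

variable {C : Type w} [Category.{v} C] [Abelian C]

/-- The injective dimension of `M`: the least `n : ℕ` such that `Ext^j(-, M) = 0` for all `j > n`,
and `⊤` if there is none. (So it is `0` for a zero object.) -/
noncomputable def injDim (M : C) : ℕ∞ :=
  ⨅ (n : ℕ) (_ : HasInjectiveDimensionLE M n), (n : ℕ∞)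

/-- The injective dimension of a class of objects: the supremum over its members. -/
noncomputable def injDimClass (Y : ObjectProperty C) : ℕ∞ :=
  ⨆ (M : C) (_ : Y M), injDim M

/-- `M` is `(X, Y)`-Gorenstein projective: it is (isomorphic to) a cycle of an exact complex `P`
with all terms in `X` such that the complex `Hom(P, F)` is exact for every `F` in `Y`. -/
def gorensteinProjective (X Y : ObjectProperty C) : ObjectProperty C := fun M =>
  ∃ P : CochainComplex C ℤ, P.Acyclic ∧ (∀ i, X (P.X i)) ∧
    (∀ F : C, Y F → ∀ (i : ℤ) (f : P.X i ⟶ F), P.d (i - 1) i ≫ f = 0 →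
      ∃ g : P.X (i + 1) ⟶ F, P.d i (i + 1) ≫ g = f) ∧
    ∃ m : ℤ, Nonempty (M ≅ P.cycles m)

/-- `HasResolution X n M`: there is an exact sequence `0 → X_n → ⋯ → X_1 → X_0 → M → 0` with all
`X_i` in `X`. It is cut into the short exact sequences `0 → K → X_0 → M → 0`, with `K` having a
resolution of length `n - 1`. -/
def HasResolution (X : ObjectProperty C) : ℕ → C → Prop
  | 0, M => ∃ X₀ : C, X X₀ ∧ Nonempty (X₀ ≅ M)
  | n + 1, M => ∃ (K X₀ : C) (i : K ⟶ X₀) (p : X₀ ⟶ M) (h : i ≫ p = 0),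
      (ShortComplex.mk i p h).ShortExact ∧ X X₀ ∧ HasResolution X n K

/-- The `X`-resolution dimension of `M`: the least `n : ℕ` such that there is an exact sequence
`0 → X_n → ⋯ → X_0 → M → 0` with all `X_i` in `X`, and `⊤` if there is none. -/
noncomputable def resDim (X : ObjectProperty C) (M : C) : ℕ∞ :=
  ⨅ (n : ℕ) (_ : HasResolution X n M), (n : ℕ∞)

variable (C) in
/-- The global `(X, Y)`-Gorenstein projective dimension of the category `C`. -/
noncomputable def globalGorensteinProjDim (X Y : ObjectProperty C) : ℕ∞ :=
  ⨆ M : C, resDim (gorensteinProjective X Y) M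

end Abelian

/-! ### Ding projective modules and `n`-Gorenstein rings -/

section Ring

variable (R : Type u) [Ring R]

/-- The left global Ding projective dimension of `R`, where a left `R`-module is Ding projective if
it is `(Proj(R), Flat(R))`-Gorenstein projective. -/
noncomputable def globalDingProjDim : ℕ∞ :=
  globalGorensteinProjDim (ModuleCat.{u} R) (isProjective (ModuleCat.{u} R)) (flatModules R)

/-- `R` is `n`-Gorenstein: it is left and right Noetherian, and its injective dimensions as a left
and as a right module over itself are at most `n`. Right modules are left modules over `Rᵐᵒᵖ`. -/
structure IsNGorenstein (n : ℕ) : Prop where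
  left_noetherian : IsNoetherian R R
  right_noetherian : IsNoetherian Rᵐᵒᵖ R
  left_injDim : injDim (ModuleCat.of R R) ≤ n
  right_injDim : injDim (ModuleCat.of Rᵐᵒᵖ R) ≤ n

end Ring

end DingDim

/-! Put $d=\mathrm{id}({}_RR)\le n$. For the upper bound it is enough that the $d$-th syzygy of
every module is Ding projective. Since $R$ is left Noetherian, all projectives have injective
dimension at most $d$. Flat modules then satisfy the same bound: their injective dimensions are
uniformly bounded, syzygies of flats are flat, and the bound can be lowered along $0\to\Omega F\to
P\to F\to 0$ until it reaches $d$ (`hasInjectiveDimensionLE_of_isFlat`). Next, injectives have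
projective dimension at most $d$. Write $M^+=\mathrm{Hom}_{\mathbb Z}(M,\mathbb Q/\mathbb Z)$; $M$
is flat iff $M^+$ is injective. For $I$ injective, right Noetherianity and $\mathrm{id}(R_R)\le n$
give $\mathrm{id}(I^+)\le n$ (`exists_extension_characterModule`), so $\Omega^nI$ is flat. Hence
$\mathrm{id}(\Omega^{d+1}I)\le d$, so $\mathrm{Ext}^1(\Omega^dI,\Omega^{d+1}I)=0$ and $\Omega^dI$ is
projective (`hasProjectiveDimensionLE_of_characterModule`). Finally, a projective resolution and an
injective coresolution of $M$ form a doubly infinite exact sequence with terms of projective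
dimension at most $d$. Taking $d$-th syzygies throughout gives an exact complex of projectives with
cycle $\Omega^dM$; it stays exact under $\mathrm{Hom}(-,F)$, $F$ flat, because $\mathrm{id}(F)\le d$
(`gorensteinProjective_syz_iterate`). The lower bound holds because $R$ is flat:
$\mathrm{Ext}^{>0}(G,R)=0$ for $G$ Ding projective, and this shifts along Ding projective
resolutions. -/

namespace DingDim

open Limits Abelian

/-! ### Dimension shifting for Ext along short exact sequences. -/

section DimensionShifting

universe w'

variable {C : Type w} [Category.{v} C] [Abelian C] [HasExt.{w'} C] {S : ShortComplex C}

lemma subsingleton_ext_X₃ (hS : S.ShortExact) {Y : C} {i : ℕ}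
    (h₁ : Subsingleton (Ext S.X₁ Y i)) (h₂ : Subsingleton (Ext S.X₂ Y (i + 1))) :
    Subsingleton (Ext S.X₃ Y (i + 1)) := by
  refine subsingleton_of_forall_eq 0 fun x ↦ ?_
  obtain ⟨y, rfl⟩ := Ext.contravariant_sequence_exact₃ hS Y x (Subsingleton.elim _ _) (add_comm 1 i)
  rw [Subsingleton.elim y 0, Ext.comp_zero]

lemma subsingleton_ext_X₁ (hS : S.ShortExact) {Y : C} {i : ℕ}
    (h₂ : Subsingleton (Ext S.X₂ Y i)) (h₃ : Subsingleton (Ext S.X₃ Y (i + 1))) :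
    Subsingleton (Ext S.X₁ Y i) := by
  refine subsingleton_of_forall_eq 0 fun x ↦ ?_
  obtain ⟨y, rfl⟩ := Ext.contravariant_sequence_exact₁ hS Y x (add_comm 1 i) (Subsingleton.elim _ _)
  rw [Subsingleton.elim y 0, Ext.comp_zero]

lemma subsingleton_ext_to_X₃ (hS : S.ShortExact) {Y : C} {i : ℕ}
    (h₂ : Subsingleton (Ext Y S.X₂ i)) (h₁ : Subsingleton (Ext Y S.X₁ (i + 1))) :
    Subsingleton (Ext Y S.X₃ i) := by
  refine subsingleton_of_forall_eq 0 fun x ↦ ?_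
  obtain ⟨y, rfl⟩ := Ext.covariant_sequence_exact₃ Y hS x rfl (Subsingleton.elim _ _)
  rw [Subsingleton.elim y 0, Ext.zero_comp]

lemma exists_extension_of_subsingleton_ext (hS : S.ShortExact) {Y : C}
    (h : Subsingleton (Ext S.X₃ Y 1)) (f : S.X₁ ⟶ Y) : ∃ g : S.X₂ ⟶ Y, S.f ≫ g = f := by
  obtain ⟨x, hx⟩ := Ext.contravariant_sequence_exact₁ hS Y (Ext.mk₀ f) rfl (Subsingleton.elim _ _)
  obtain ⟨g, rfl⟩ := Ext.homEquiv₀.symm.surjective x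
  refine ⟨g, Ext.homEquiv₀.symm.injective ?_⟩
  simpa using hx

lemma subsingleton_ext_one_of_exists_extension (hS : S.ShortExact) {Y : C}
    (h₂ : Subsingleton (Ext S.X₂ Y 1)) (h : ∀ f : S.X₁ ⟶ Y, ∃ g : S.X₂ ⟶ Y, S.f ≫ g = f) :
    Subsingleton (Ext S.X₃ Y 1) := by
  refine subsingleton_of_forall_eq 0 fun x ↦ ?_
  obtain ⟨y, rfl⟩ := Ext.contravariant_sequence_exact₃ hS Y x (Subsingleton.elim _ _)
    (add_comm 1 0)
  obtain ⟨f, rfl⟩ := Ext.homEquiv₀.symm.surjective y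
  obtain ⟨g, rfl⟩ := h f
  simp [← Ext.mk₀_comp_mk₀]

lemma subsingleton_ext_of_iso {M N F : C} (e : M ≅ N) {n : ℕ} (h : Subsingleton (Ext N F n)) :
    Subsingleton (Ext M F n) := by
  refine subsingleton_of_forall_eq 0 fun x ↦ ?_
  rw [← x.mk₀_id_comp, ← e.hom_inv_id, ← Ext.mk₀_comp_mk₀, Ext.comp_assoc_of_second_deg_zero,
    Subsingleton.elim ((Ext.mk₀ e.inv).comp x _) 0, Ext.comp_zero]

end DimensionShifting

/-! ### Complexes spliced from short exact sequences; Ext out of Gorenstein projectives. -/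

section Gorenstein

variable {C : Type w} [Category.{v} C] [Abelian C]

section Splice

variable {G P : ℤ → C} (f : ∀ i, G i ⟶ P i) (g : ∀ i, P i ⟶ G (i + 1))
  (zero : ∀ i, f i ≫ g i = 0)

/-- The cochain complex obtained by splicing short exact sequences `G i ⟶ P i ⟶ G (i + 1)`. -/
noncomputable abbrev splice : CochainComplex C ℤ :=
  CochainComplex.of P (fun i ↦ g i ≫ f (i + 1)) (fun i ↦ by simp [reassoc_of% zero (i + 1)])

lemma splice_d (i : ℤ) : (splice f g zero).d i (i + 1) = g i ≫ f (i + 1) :=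
  CochainComplex.of_d P (fun i ↦ g i ≫ f (i + 1)) i

variable {f g zero} (h : ∀ i, (ShortComplex.mk _ _ (zero i)).ShortExact)

include h in
lemma splice_acyclic : (splice f g zero).Acyclic := by
  intro j
  obtain ⟨i, rfl⟩ : ∃ i, j = i + 1 := ⟨j - 1, by simp⟩
  rw [HomologicalComplex.exactAt_iff_exact_up_to_refinements _ i (i + 1) (i + 1 + 1)
    (by simp) (by simp)]
  intro A x hx
  have := (h i).epi_g
  have := (h (i + 1)).mono_f
  have := (h (i + 1 + 1)).mono_f
  rw [splice_d] at hx ⊢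
  have hx' : x ≫ g (i + 1) = 0 := by
    rw [← cancel_mono (f (i + 1 + 1)), zero_comp, Category.assoc]
    exact hx
  obtain ⟨A', π, hπ, y, hy⟩ := surjective_up_to_refinements_of_epi (g i)
    ((h (i + 1)).exact.lift x hx')
  refine ⟨A', π, hπ, y, ?_⟩
  have := (h (i + 1)).exact.lift_f x hx'
  dsimp at this hy
  rw [← reassoc_of% hy, this]

-- A map from a term to $F$ killed by the incoming differential factors through the next `G`,
-- because the `g i` are epi, and then extends along `f`. As the `f i` are mono, the kernel of the
-- differential at $0$ is `G 0`.
include h in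
lemma splice_gorensteinProjective {X Y : ObjectProperty C} (hP : ∀ i, X (P i))
    (hY : ∀ F : C, Y F → ∀ i (a : G i ⟶ F), ∃ b : P i ⟶ F, f i ≫ b = a) :
    gorensteinProjective X Y (G 0) := by
  refine ⟨splice f g zero, splice_acyclic h, hP, fun F hF i a ha ↦ ?_, 0, ⟨?_⟩⟩
  · obtain ⟨i, rfl⟩ : ∃ j, i = j + 1 := ⟨i - 1, by simp⟩
    have e : i + 1 - 1 = i := by simp
    rw [e, splice_d] at ha
    rw [splice_d]
    change P (i + 1) ⟶ F at a
    have := (h i).epi_g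
    have := (h (i + 1)).epi_g
    have ha' : f (i + 1) ≫ a = 0 := by
      rw [← cancel_epi (g i), comp_zero, ← Category.assoc]
      exact ha
    obtain ⟨b, hb⟩ := hY F hF (i + 1 + 1) ((h (i + 1)).exact.desc a ha')
    refine ⟨b, ?_⟩
    have := (h (i + 1)).exact.g_desc a ha'
    dsimp at this
    rw [Category.assoc, hb, this]
  · have := (h 0).mono_f
    have : Mono (f (0 + 1)) := (h (0 + 1)).mono_f
    have w : f 0 ≫ (splice f g zero).d 0 (0 + 1) = 0 := by
      rw [splice_d, reassoc_of% zero 0, zero_comp]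
    have hl : IsLimit (KernelFork.ofι (f := (splice f g zero).d 0 (0 + 1)) (f 0) w) :=
      KernelFork.IsLimit.ofι' (f 0) w fun {A} k hk ↦ by
        rw [splice_d] at hk
        have hk' : k ≫ g 0 = 0 := by
          rw [← cancel_mono (f (0 + 1)), zero_comp, Category.assoc]
          exact hk
        exact ⟨(h 0).exact.lift k hk', (h 0).exact.lift_f k hk'⟩
    exact hl.conePointUniqueUpToIso ((splice f g zero).cyclesIsKernel 0 (0 + 1) (by simp))

end Splice

/-- Splice copies of the split sequence $P\to P\oplus P\to P$. -/
lemma gorensteinProjective_of_projective {Y : ObjectProperty C} {P : C} [Projective P] :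
    gorensteinProjective (isProjective C) Y P :=
  splice_gorensteinProjective (G := fun _ ↦ P) (P := fun _ ↦ P ⊞ P)
    (f := fun _ ↦ biprod.inl) (g := fun _ ↦ biprod.snd) (zero := fun _ ↦ by simp)
    (fun _ ↦ (ShortComplex.Splitting.ofHasBinaryBiproduct P P).shortExact)
    (fun _ ↦ inferInstanceAs (Projective (P ⊞ P)))
    (fun _ _ _ a ↦ ⟨biprod.desc a 0, by simp⟩)

section Cycles

lemma cycles_shortExact {K : CochainComplex C ℤ} (hK : K.Acyclic) (i : ℤ) :
    ∃ w, (ShortComplex.mk (K.iCycles i) (K.toCycles i (i + 1)) w).ShortExact := by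
  have w : K.iCycles i ≫ K.toCycles i (i + 1) = 0 := by
    simp [← cancel_mono (K.iCycles (i + 1))]
  have : Epi (K.toCycles i (i + 1)) := by
    rw [epi_iff_surjective_up_to_refinements]
    intro A y
    obtain ⟨A', π, hπ, x, hx⟩ := (K.exactAt_iff_exact_up_to_refinements i (i + 1) (i + 1 + 1)
      (by simp) (by simp)).1 (hK _) (y ≫ K.iCycles (i + 1)) (by simp)
    refine ⟨A', π, hπ, x, ?_⟩
    simpa [← cancel_mono (K.iCycles (i + 1))] using hx
  refine ⟨w, { exact := ShortComplex.exact_of_f_is_kernel _ ?_ }⟩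
  exact KernelFork.IsLimit.ofι' _ _ fun {A} k hk ↦
    ⟨K.liftCycles k (i + 1) (by simp) (by
      rw [← K.toCycles_i, reassoc_of% hk, zero_comp]), by simp⟩

universe w'
variable [HasExt.{w'} C]

/-- Passing from $Z^m$ to $Z^{m+1}$ raises the degree of Ext by one, so only $\mathrm{Ext}^1$ needs
work. There a map $Z^m\to F$, pulled back to the preceding term, is a cocycle of
$\mathrm{Hom}(K,F)$; exactness extends it to the term containing $Z^m$. -/
lemma subsingleton_ext_cycles {K : CochainComplex C ℤ} (hK : K.Acyclic)
    (hP : ∀ i, Projective (K.X i)) {F : C}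
    (hF : ∀ (i : ℤ) (f : K.X i ⟶ F), K.d (i - 1) i ≫ f = 0 →
      ∃ g : K.X (i + 1) ⟶ F, K.d i (i + 1) ≫ g = f) (n : ℕ) (m : ℤ) :
    Subsingleton (Ext (K.cycles m) F (n + 1)) := by
  obtain ⟨m, rfl⟩ : ∃ j, m = j + 1 := ⟨m - 1, by simp⟩
  induction n generalizing m with
  | succ n ih =>
    have ih' := ih (m - 1)
    obtain ⟨w, hw⟩ := cycles_shortExact hK m
    rw [sub_add_cancel] at ih'
    exact subsingleton_ext_X₃ hw ih' (Ext.subsingleton_of_projective _ _ _)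
  | zero =>
    obtain ⟨w, hw⟩ := cycles_shortExact hK m
    refine subsingleton_ext_one_of_exists_extension hw
      (Ext.subsingleton_of_projective _ _ _) fun a ↦ ?_
    obtain ⟨m, rfl⟩ : ∃ j, m = j + 1 := ⟨m - 1, by simp⟩
    obtain ⟨_, hw'⟩ := cycles_shortExact hK m
    have := hw'.epi_g
    dsimp at this a
    have hd : K.d (m - 1) m ≫ K.toCycles m (m + 1) = 0 := by
      simp
    obtain ⟨b, hb⟩ := hF m (K.toCycles m (m + 1) ≫ a) (by rw [reassoc_of% hd, zero_comp])
    refine ⟨b, ?_⟩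
    rw [← cancel_epi (K.toCycles m (m + 1)), ← hb]
    simp

lemma subsingleton_ext_of_gorensteinProjective {Y : ObjectProperty C} {M F : C}
    (hM : gorensteinProjective (isProjective C) Y M) (hF : Y F) (i : ℕ) :
    Subsingleton (Ext M F (i + 1)) := by
  obtain ⟨K, hK, hP, hY, m, ⟨e⟩⟩ := hM
  exact subsingleton_ext_of_iso e (subsingleton_ext_cycles hK hP (hY F hF) i m)

lemma subsingleton_ext_of_hasResolution {X : ObjectProperty C} {F : C}
    (hX : ∀ M : C, X M → ∀ i : ℕ, Subsingleton (Ext M F (i + 1))) {k : ℕ} {M : C}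
    (hM : HasResolution X k M) (i : ℕ) : Subsingleton (Ext M F (i + k + 1)) := by
  induction k generalizing M with
  | zero =>
    obtain ⟨X₀, h, ⟨e⟩⟩ := hM
    exact subsingleton_ext_of_iso e.symm (hX X₀ h i)
  | succ k ih =>
    obtain ⟨K, X₀, _, _, _, hS, h, hK⟩ := hM
    exact subsingleton_ext_X₃ hS (ih hK) (hX X₀ h _)

end Cycles

end Gorenstein

/-! ### Syzygies, cosyzygies and the horseshoe lemma. -/

section Syzygy

variable {R : Type u} [Ring R]

/-- The first syzygy of `M`: the kernel of the canonical surjection from a free module. -/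
noncomputable def syz (M : ModuleCat.{u} R) : ModuleCat.{u} R := M.projectiveShortComplex.X₁

lemma exists_shortExact_syz (M : ModuleCat.{u} R) :
    ∃ (P : ModuleCat.{u} R) (f : syz M ⟶ P) (g : P ⟶ M) (w : f ≫ g = 0),
      (ShortComplex.mk f g w).ShortExact ∧ Projective P :=
  ⟨_, _, _, _, M.shortExact_projectiveShortComplex, inferInstance⟩

/-- The first cosyzygy of `M`: the cokernel of an embedding into an injective module. -/
noncomputable def cosyz (M : ModuleCat.{u} R) : ModuleCat.{u} R := cokernel (Injective.ι M)

lemma exists_shortExact_cosyz (M : ModuleCat.{u} R) :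
    ∃ (I : ModuleCat.{u} R) (f : M ⟶ I) (g : I ⟶ cosyz M) (w : f ≫ g = 0),
      (ShortComplex.mk f g w).ShortExact ∧ Injective I :=
  ⟨_, Injective.ι M, cokernel.π _, cokernel.condition _,
    { exact := ShortComplex.exact_cokernel _
      epi_g := inferInstanceAs (Epi (cokernel.π _)) }, inferInstance⟩

lemma subsingleton_ext_syz_iterate {M F : ModuleCat.{u} R} (d i : ℕ)
    (h : Subsingleton (Ext M F (i + d + 1))) : Subsingleton (Ext (syz^[d] M) F (i + 1)) := by
  induction d generalizing M with
  | zero => exact h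
  | succ d ih =>
    obtain ⟨P, f, g, w, hS, hP⟩ := exists_shortExact_syz M
    exact ih (subsingleton_ext_X₁ hS (Ext.subsingleton_of_projective _ _ _) h)

lemma hasResolution_of_syz_iterate {X : ObjectProperty (ModuleCat.{u} R)}
    (hX : ∀ P, Projective P → X P) (d : ℕ) {M : ModuleCat.{u} R} (h : X (syz^[d] M)) :
    HasResolution X d M := by
  induction d generalizing M with
  | zero => exact ⟨M, h, ⟨Iso.refl M⟩⟩
  | succ d ih =>
    obtain ⟨P, f, g, w, hS, hP⟩ := exists_shortExact_syz M
    exact ⟨syz M, P, f, g, w, hS, hX P hP, ih h⟩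

/-- The horseshoe lemma, for one step of projective resolutions. -/
lemma exists_shortExact_horseshoe {C : Type w} [Category.{v} C] [Abelian C] {S : ShortComplex C}
    (hS : S.ShortExact) {K₁ P₁ K₃ P₃ : C}
    {i₁ : K₁ ⟶ P₁} {p₁ : P₁ ⟶ S.X₁} {w₁ : i₁ ≫ p₁ = 0} (h₁ : (ShortComplex.mk _ _ w₁).ShortExact)
    {i₃ : K₃ ⟶ P₃} {p₃ : P₃ ⟶ S.X₃} {w₃ : i₃ ≫ p₃ = 0} (h₃ : (ShortComplex.mk _ _ w₃).ShortExact)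
    [Projective P₃] :
    ∃ (K : C) (f : K₁ ⟶ K) (g : K ⟶ K₃) (w : f ≫ g = 0) (i : K ⟶ P₁ ⊞ P₃) (p : P₁ ⊞ P₃ ⟶ S.X₂)
      (w' : i ≫ p = 0), (ShortComplex.mk f g w).ShortExact ∧ (ShortComplex.mk i p w').ShortExact := by
  have := hS.mono_f
  have := hS.epi_g
  have : Mono i₁ := h₁.mono_f
  have : Mono i₃ := h₃.mono_f
  have : Epi p₁ := h₁.epi_g
  have : Epi p₃ := h₃.epi_g
  let q : P₃ ⟶ S.X₂ := Projective.factorThru p₃ S.g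
  have hq : q ≫ S.g = p₃ := Projective.factorThru_comp _ _
  let p : P₁ ⊞ P₃ ⟶ S.X₂ := biprod.desc (p₁ ≫ S.f) q
  have hp : p ≫ S.g = biprod.snd ≫ p₃ := by
    ext <;> simp [p, hq]
  have hι : kernel.ι p ≫ biprod.snd ≫ p₃ = 0 := by rw [← hp, kernel.condition_assoc, zero_comp]
  let f : K₁ ⟶ kernel p := kernel.lift p (i₁ ≫ biprod.inl) (by simp [p, reassoc_of% w₁])
  let g : kernel p ⟶ K₃ := h₃.exact.lift (kernel.ι p ≫ biprod.snd) (by simpa using hι)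
  have hg : g ≫ i₃ = kernel.ι p ≫ biprod.snd := h₃.exact.lift_f _ _
  have w : f ≫ g = 0 := by simp [← cancel_mono i₃, hg, f]
  have hfι : f ≫ kernel.ι p = i₁ ≫ biprod.inl := kernel.lift_ι _ _ _
  have : Mono f := by
    have : Mono (f ≫ kernel.ι p) := by rw [hfι]; infer_instance
    exact mono_of_mono f (kernel.ι p)
  have : Epi g := by
    rw [epi_iff_surjective_up_to_refinements]
    intro A y
    have hy : (y ≫ i₃ ≫ q) ≫ S.g = 0 := by simp [hq, w₃]
    obtain ⟨A', π, hπ, b, hb⟩ := surjective_up_to_refinements_of_epi p₁ (hS.exact.lift _ hy)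
    have hb' : π ≫ y ≫ i₃ ≫ q = b ≫ p₁ ≫ S.f := by
      rw [← reassoc_of% hb, hS.exact.lift_f]
    -- The lift of an element of $K_3$ through `q` lands in $X_1$; subtracting its preimage `b` in
    -- $P_1$ moves it into the kernel of `p`.
    refine ⟨A', π, hπ, kernel.lift p (biprod.lift (-b) (π ≫ y ≫ i₃)) (by simp [p, hb']), ?_⟩
    simp [← cancel_mono i₃, hg]
  have : Epi p := by
    rw [epi_iff_surjective_up_to_refinements]
    intro A y
    obtain ⟨A', π, hπ, z, hz⟩ := surjective_up_to_refinements_of_epi p₃ (y ≫ S.g)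
    have hy : (π ≫ y - z ≫ q) ≫ S.g = 0 := by simp [hq, hz]
    obtain ⟨A'', π', hπ', b, hb⟩ := surjective_up_to_refinements_of_epi p₁ (hS.exact.lift _ hy)
    have hb' : π' ≫ (π ≫ y - z ≫ q) = b ≫ p₁ ≫ S.f := by
      rw [← reassoc_of% hb, hS.exact.lift_f]
    refine ⟨A'', π' ≫ π, inferInstance, biprod.lift b (π' ≫ z), ?_⟩
    simp [p, ← hb']
  refine ⟨kernel p, f, g, w, kernel.ι p, p, kernel.condition p,
    { exact := ShortComplex.exact_of_f_is_kernel _ ?_ }, { exact := ShortComplex.exact_kernel p }⟩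
  refine KernelFork.IsLimit.ofι' _ _ fun {A} k hk ↦ ?_
  have hk₃ : k ≫ kernel.ι p ≫ biprod.snd = 0 := by rw [← hg, reassoc_of% hk, zero_comp]
  have hk₁ : (k ≫ kernel.ι p ≫ biprod.fst) ≫ p₁ = 0 := by
    have e' : biprod.fst ≫ p₁ ≫ S.f + biprod.snd ≫ q = p := by ext <;> simp [p]
    have e : k ≫ kernel.ι p ≫ (biprod.fst ≫ p₁ ≫ S.f + biprod.snd ≫ q) = 0 := by
      rw [e', kernel.condition, comp_zero]
    rw [Preadditive.comp_add, Preadditive.comp_add, reassoc_of% hk₃, zero_comp, add_zero] at e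
    simpa [← cancel_mono S.f] using e
  refine ⟨h₁.exact.lift _ hk₁, ?_⟩
  have := h₁.exact.lift_f _ hk₁
  dsimp at this
  rw [← cancel_mono (kernel.ι p), Category.assoc, hfι, reassoc_of% this]
  ext
  · simp
  · simp [hk₃]

/-- The horseshoe middle term is a syzygy of $X_2$ for $P_1\oplus P_3$ rather than for the canonical
free cover, so only its projective dimension is recorded. -/
lemma exists_shortExact_syz_syz {S : ShortComplex (ModuleCat.{u} R)} (hS : S.ShortExact) :
    ∃ (K : ModuleCat.{u} R) (f : syz S.X₁ ⟶ K) (g : K ⟶ syz S.X₃) (w : f ≫ g = 0),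
      (ShortComplex.mk f g w).ShortExact ∧
      ∀ k : ℕ, HasProjectiveDimensionLE S.X₂ (k + 1) → HasProjectiveDimensionLE K k := by
  obtain ⟨P₁, i₁, p₁, w₁, h₁, hP₁⟩ := exists_shortExact_syz S.X₁
  obtain ⟨P₃, i₃, p₃, w₃, h₃, hP₃⟩ := exists_shortExact_syz S.X₃
  obtain ⟨K, f, g, w, i, p, w', h, h'⟩ := exists_shortExact_horseshoe hS h₁ h₃
  exact ⟨K, f, g, w, h, fun k hk ↦
    (h'.hasProjectiveDimensionLT_X₃_iff k (inferInstanceAs (Projective (P₁ ⊞ P₃)))).1 hk⟩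

lemma exists_shortExact_syz_iterate (d : ℕ) {S : ShortComplex (ModuleCat.{u} R)}
    (hS : S.ShortExact) (h : HasProjectiveDimensionLE S.X₂ d) :
    ∃ (P : ModuleCat.{u} R) (f : syz^[d] S.X₁ ⟶ P) (g : P ⟶ syz^[d] S.X₃) (w : f ≫ g = 0),
      (ShortComplex.mk f g w).ShortExact ∧ Projective P := by
  induction d generalizing S with
  | zero => exact ⟨_, S.f, S.g, S.zero, hS, (projective_iff_hasProjectiveDimensionLE_zero _).2 h⟩
  | succ d ih =>
    obtain ⟨K, f, g, w, h', hK⟩ := exists_shortExact_syz_syz hS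
    exact ih h' (hK d h)

/-- A sequence of modules, indexed by `ℤ`, made of `M`, its syzygies and its cosyzygies. -/
noncomputable def intSyz (M : ModuleCat.{u} R) : ℤ → ModuleCat.{u} R
  | Int.ofNat n => cosyz^[n] M
  | Int.negSucc n => syz^[n + 1] M

lemma exists_shortExact_intSyz (M : ModuleCat.{u} R) (i : ℤ) :
    ∃ (E : ModuleCat.{u} R) (f : intSyz M i ⟶ E) (g : E ⟶ intSyz M (i + 1)) (w : f ≫ g = 0),
      (ShortComplex.mk f g w).ShortExact ∧ (Projective E ∨ Injective E) := by
  match i with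
  | Int.ofNat n =>
    have key := exists_shortExact_cosyz (cosyz^[n] M)
    rw [← Function.iterate_succ_apply' cosyz] at key
    obtain ⟨E, f, g, w, h, hE⟩ := key
    exact ⟨E, f, g, w, h, .inr hE⟩
  -- The seam at index $-1$, where the syzygies meet $M$ at index $0$.
  | Int.negSucc 0 =>
    obtain ⟨E, f, g, w, h, hE⟩ := exists_shortExact_syz M
    exact ⟨E, f, g, w, h, .inl hE⟩
  | Int.negSucc (n + 1) =>
    have key := exists_shortExact_syz (syz^[n + 1] M)
    rw [← Function.iterate_succ_apply' syz] at key
    obtain ⟨E, f, g, w, h, hE⟩ := key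
    exact ⟨E, f, g, w, h, .inl hE⟩

/-- The $d$-th syzygies of the sequence `intSyz M` are linked by short exact sequences with
projective middle terms. Maps to $F$ in `Y` extend along them since $\mathrm{Ext}^1(\Omega^dN,F)$ is
a shift of $\mathrm{Ext}^{d+1}(N,F)=0$. -/
theorem gorensteinProjective_syz_iterate {Y : ObjectProperty (ModuleCat.{u} R)} {d : ℕ}
    (hI : ∀ I : ModuleCat.{u} R, Injective I → HasProjectiveDimensionLE I d)
    (hY : ∀ F, Y F → HasInjectiveDimensionLE F d) (M : ModuleCat.{u} R) :
    gorensteinProjective (isProjective (ModuleCat.{u} R)) Y (syz^[d] M) := by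
  have key (i : ℤ) : ∃ (P : ModuleCat.{u} R) (f : syz^[d] (intSyz M i) ⟶ P)
      (g : P ⟶ syz^[d] (intSyz M (i + 1))) (w : f ≫ g = 0),
      (ShortComplex.mk f g w).ShortExact ∧ Projective P := by
    obtain ⟨E, f, g, w, h, hE⟩ := exists_shortExact_intSyz M i
    refine exists_shortExact_syz_iterate d h ?_
    obtain hE | hE := hE
    · exact hasProjectiveDimensionLT_of_ge E 1 (d + 1) (by simp)
    · exact hI E hE
  choose P f g w h hP using key
  refine splice_gorensteinProjective (G := fun i ↦ syz^[d] (intSyz M i)) h hP fun F hF i a ↦ ?_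
  have := hY F hF
  exact exists_extension_of_subsingleton_ext (h i) (subsingleton_ext_syz_iterate d 0
    (HasInjectiveDimensionLT.subsingleton F (d + 1) _ (by simp) _)) a

end Syzygy

/-! ### Injective dimension over Noetherian rings, tested on finite modules. -/

section Noetherian

variable {R : Type u} [Ring R]

lemma exists_comp_eq_of_ker_le {M N Q : Type*} [AddCommGroup M] [AddCommGroup N] [AddCommGroup Q]
    [Module R M] [Module R N] [Module R Q] (hQ : Module.Baer R Q) (θ : M →ₗ[R] N) (φ : M →ₗ[R] Q)
    (h : LinearMap.ker θ ≤ LinearMap.ker φ) : ∃ ψ : N →ₗ[R] Q, ψ ∘ₗ θ = φ := by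
  obtain ⟨ψ, hψ⟩ := hQ.extension_property ((LinearMap.ker θ).liftQ θ le_rfl)
    (LinearMap.ker_eq_bot.1 (Submodule.ker_liftQ_eq_bot _ _ _ le_rfl)) ((LinearMap.ker θ).liftQ φ h)
  refine ⟨ψ, LinearMap.ext fun x ↦ ?_⟩
  simpa using LinearMap.congr_fun hψ (Submodule.Quotient.mk x)

lemma exists_shortExact_of_finite [IsNoetherianRing R] (A : ModuleCat.{u} R) [Module.Finite R A] :
    ∃ (m : ℕ) (B : Submodule R (Fin m → R)) (p : ModuleCat.of R (Fin m → R) ⟶ A)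
      (w : ModuleCat.ofHom B.subtype ≫ p = 0), (ShortComplex.mk _ _ w).ShortExact := by
  obtain ⟨m, f, hf⟩ := Module.Finite.exists_fin' R A
  exact ⟨m, LinearMap.ker f, ModuleCat.ofHom f, _, LinearMap.shortExact_shortComplexKer hf⟩

/-- Over a left Noetherian ring, vanishing of `Ext(A, Z)` for finite `A` implies that of
`Ext(A, W)` as soon as extending maps to `Z` from submodules of finite free modules implies
extending maps to `W`. -/
lemma subsingleton_ext_of_extension_property [IsNoetherianRing R] {Z W : ModuleCat.{u} R}
    (h : ∀ (m : ℕ) (B : Submodule R (Fin m → R)),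
      (∀ f : B →ₗ[R] Z, ∃ g : (Fin m → R) →ₗ[R] Z, g ∘ₗ B.subtype = f) →
      ∀ f : B →ₗ[R] W, ∃ g : (Fin m → R) →ₗ[R] W, g ∘ₗ B.subtype = f)
    (j : ℕ) (A : ModuleCat.{u} R) [Module.Finite R A] (hA : Subsingleton (Ext A Z (j + 1))) :
    Subsingleton (Ext A W (j + 1)) := by
  induction j generalizing A with
  | zero =>
    obtain ⟨m, B, p, w, hS⟩ := exists_shortExact_of_finite A
    have key := h m B fun f ↦ by
      obtain ⟨g, hg⟩ := exists_extension_of_subsingleton_ext hS hA (ModuleCat.ofHom f)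
      exact ⟨g.hom, congr(($hg).hom)⟩
    refine subsingleton_ext_one_of_exists_extension hS (Ext.subsingleton_of_projective _ _ _)
      fun f ↦ ?_
    obtain ⟨g, hg⟩ := key f.hom
    exact ⟨ModuleCat.ofHom g, ModuleCat.hom_ext hg⟩
  | succ j ih =>
    -- The kernel `B` is again finite by Noetherianity, so the degree can be lowered.
    obtain ⟨m, B, p, w, hS⟩ := exists_shortExact_of_finite A
    exact subsingleton_ext_X₃ hS (ih (ModuleCat.of R B)
      (subsingleton_ext_X₁ hS (Ext.subsingleton_of_projective _ _ _) hA))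
      (Ext.subsingleton_of_projective _ _ _)

lemma injective_of_subsingleton_ext_finite {W : ModuleCat.{u} R}
    (h : ∀ A : ModuleCat.{u} R, Module.Finite R A → Subsingleton (Ext A W 1)) : Injective W := by
  refine (Module.injective_iff_injective_object R W).1 (Module.Baer.injective fun I f ↦ ?_)
  have hS := ModuleCat.shortComplex_shortExact
    (ModuleCat.shortComplexOfCompEqZero I.subtype I.mkQ (by ext; simp))
    (LinearMap.exact_subtype_mkQ I) I.injective_subtype I.mkQ_surjective
  obtain ⟨g, hg⟩ := exists_extension_of_subsingleton_ext hS
    (h (ModuleCat.of R (R ⧸ I)) inferInstance) (ModuleCat.ofHom f)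
  exact ⟨g.hom, fun x hx ↦ congr(($hg).hom ⟨x, hx⟩)⟩

/-- Baer's criterion for injective dimension. -/
lemma hasInjectiveDimensionLE_of_subsingleton_ext_finite (d : ℕ) {W : ModuleCat.{u} R}
    (h : ∀ A : ModuleCat.{u} R, Module.Finite R A → Subsingleton (Ext A W (d + 1))) :
    HasInjectiveDimensionLE W d := by
  induction d generalizing W with
  | zero =>
    have := injective_of_subsingleton_ext_finite h
    exact inferInstanceAs (HasInjectiveDimensionLT W 1)
  | succ d ih =>
    obtain ⟨I, f, g, w, hS, hI⟩ := exists_shortExact_cosyz W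
    refine (hS.hasInjectiveDimensionLT_X₃_iff d hI).1 (ih fun A hA ↦ ?_)
    exact subsingleton_ext_to_X₃ hS (Ext.subsingleton_of_injective _ _ _) (h A hA)

/-- As `B` is finitely generated, its image lies in finitely many coordinates, and extending each of
these suffices. -/
lemma exists_extension_finsupp [IsNoetherianRing R] {m : ℕ} (B : Submodule R (Fin m → R))
    (hB : ∀ f : B →ₗ[R] R, ∃ g : (Fin m → R) →ₗ[R] R, g ∘ₗ B.subtype = f) {X : Type*}
    (f : B →ₗ[R] (X →₀ R)) : ∃ g : (Fin m → R) →ₗ[R] (X →₀ R), g ∘ₗ B.subtype = f := by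
  classical
  obtain ⟨s, hs⟩ := (Module.Finite.fg_top (R := R) (M := B)).map f
  rw [Submodule.map_top] at hs
  let T : Finset X := s.biUnion Finsupp.support
  have hT (b : B) : (f b).support ⊆ T := by
    have h : Submodule.span R (s : Set (X →₀ R)) ≤ Finsupp.supported R R (T : Set X) :=
      Submodule.span_le.2 fun t ht ↦ (Finsupp.mem_supported R t).2 (by
        exact_mod_cast Finset.subset_biUnion_of_mem Finsupp.support ht)
    exact_mod_cast (Finsupp.mem_supported R _).1 (h (hs ▸ LinearMap.mem_range_self f b))
  choose g hg using fun x ↦ hB (Finsupp.lapply x ∘ₗ f)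
  refine ⟨∑ x ∈ T, Finsupp.lsingle x ∘ₗ g x, LinearMap.ext fun b ↦ ?_⟩
  have hg' (x : X) : g x b = f b x := LinearMap.congr_fun (hg x) b
  conv_rhs => rw [← Finsupp.sum_single (f b), Finsupp.sum_of_support_subset _ (hT b) _ (by simp)]
  simp [hg']

lemma hasInjectiveDimensionLE_of_projective [IsNoetherianRing R] {d : ℕ}
    (hd : HasInjectiveDimensionLE (ModuleCat.of R R) d) (P : ModuleCat.{u} R) [hP : Projective P] :
    HasInjectiveDimensionLE P d := by
  have h : HasInjectiveDimensionLE (ModuleCat.of R (P →₀ R)) d :=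
    hasInjectiveDimensionLE_of_subsingleton_ext_finite d fun A hA ↦
      subsingleton_ext_of_extension_property (Z := ModuleCat.of R R)
        (fun m B hB f ↦ exists_extension_finsupp B hB f) d A
        (HasInjectiveDimensionLT.subsingleton _ (d + 1) _ le_rfl _)
  have : Module.Projective R P := (IsProjective.iff_projective P).2 hP
  obtain ⟨s, hs⟩ := Module.projective_def.1 this
  exact Retract.hasInjectiveDimensionLT (Y := ModuleCat.of R (P →₀ R))
    { i := ModuleCat.ofHom s
      r := ModuleCat.ofHom (Finsupp.linearCombination R id)
      retract := ModuleCat.hom_ext (LinearMap.ext hs) } (d + 1)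

end Noetherian

/-! ### Character modules, tensor-hom adjunction and flatness. -/

section Character

variable {R : Type u} [Ring R]

/-- The character module of a left module is a right module. -/
instance CharacterModule.instModuleMulOpposite (M : Type*) [AddCommGroup M] [Module R M] :
    Module Rᵐᵒᵖ (CharacterModule M) where
  smul r c := AddMonoidHom.comp c (DistribSMul.toAddMonoidHom M r.unop)
  one_smul c := CharacterModule.ext _ fun x ↦ congr(c $(one_smul R x))
  mul_smul r s c := CharacterModule.ext _ fun x ↦ congr(c $(mul_smul s.unop r.unop x))
  smul_zero _ := rfl
  smul_add _ _ _ := rfl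
  add_smul r s c := CharacterModule.ext _ fun x ↦
    (congr(c $(add_smul r.unop s.unop x))).trans (map_add c _ _)
  zero_smul c := CharacterModule.ext _ fun x ↦ (congr(c $(zero_smul R x))).trans (map_zero c)

lemma CharacterModule.op_smul_apply {M : Type*} [AddCommGroup M] [Module R M] (r : Rᵐᵒᵖ)
    (c : CharacterModule M) (x : M) : (r • c) x = c (r.unop • x) := rfl

lemma exists_character_extension {A B : Type*} [AddCommGroup A] [AddCommGroup B] (f : A →+ B)
    (hf : Function.Injective f) (c : CharacterModule A) :
    ∃ c' : CharacterModule B, ∀ a, c' (f a) = c a := by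
  obtain ⟨c', h⟩ := CharacterModule.dual_surjective_of_injective f.toIntLinearMap hf c
  exact ⟨c', fun a ↦ congr($h a)⟩

section Tensor

variable {A : Type u} [AddCommGroup A] [Module Rᵐᵒᵖ A] {M : Type u} [AddCommGroup M] [Module R M]

/-- The character of `A ⊗_R M` defined by a morphism from `A` to the character module of `M`. -/
noncomputable def BalancedTensor.uncurry (g : A →ₗ[Rᵐᵒᵖ] CharacterModule M) :
    CharacterModule (BalancedTensor R A M) :=
  QuotientAddGroup.lift (balancedRel R A M)
    (TensorProduct.liftAddHom (R := ℤ) (P := AddCircle (1 : ℚ)) g.toAddMonoidHom fun r a m ↦ by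
      change g (r • a) m = g a (r • m)
      rw [map_zsmul, map_zsmul (g a)]
      rfl) (by
    rw [balancedRel, AddSubgroup.closure_le]
    rintro _ ⟨a, r, m, rfl⟩
    rw [SetLike.mem_coe, AddMonoidHom.mem_ker, map_sub]
    change g (MulOpposite.op r • a) m - g a (r • m) = 0
    rw [map_smul, CharacterModule.op_smul_apply, MulOpposite.unop_op, sub_self])

lemma BalancedTensor.uncurry_mk (g : A →ₗ[Rᵐᵒᵖ] CharacterModule M) (a : A) (m : M) :
    uncurry g (QuotientAddGroup.mk (a ⊗ₜ[ℤ] m)) = g a m := rfl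

/-- The morphism from `A` to the character module of `M` defined by a character of `A ⊗_R M`. -/
noncomputable def BalancedTensor.curry (c : CharacterModule (BalancedTensor R A M)) :
    A →ₗ[Rᵐᵒᵖ] CharacterModule M where
  toFun a := AddMonoidHom.comp c
    ((QuotientAddGroup.mk' (balancedRel R A M)).comp (TensorProduct.mk ℤ A M a).toAddMonoidHom)
  map_add' a b := CharacterModule.ext _ fun m ↦ by
    change c (QuotientAddGroup.mk ((a + b) ⊗ₜ[ℤ] m)) = _
    rw [TensorProduct.add_tmul, QuotientAddGroup.mk_add, map_add]
    rfl
  map_smul' r a := CharacterModule.ext _ fun m ↦ by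
    refine congr(c $(QuotientAddGroup.eq_iff_sub_mem.2 ?_))
    exact AddSubgroup.subset_closure ⟨a, r.unop, m, rfl⟩

lemma BalancedTensor.curry_apply (c : CharacterModule (BalancedTensor R A M)) (a : A) (m : M) :
    curry c a m = c (QuotientAddGroup.mk (a ⊗ₜ[ℤ] m)) := rfl

lemma BalancedTensor.map_mk {B : Type u} [AddCommGroup B] [Module Rᵐᵒᵖ B] (f : A →ₗ[Rᵐᵒᵖ] B)
    (a : A) (m : M) : BalancedTensor.map f M (QuotientAddGroup.mk (a ⊗ₜ[ℤ] m)) =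
      QuotientAddGroup.mk (f a ⊗ₜ[ℤ] m) := rfl

lemma BalancedTensor.character_ext {c c' : CharacterModule (BalancedTensor R A M)}
    (h : ∀ a m, c (QuotientAddGroup.mk (a ⊗ₜ[ℤ] m)) = c' (QuotientAddGroup.mk (a ⊗ₜ[ℤ] m))) :
    c = c' := by
  refine CharacterModule.ext _ fun t ↦ ?_
  obtain ⟨t, rfl⟩ := QuotientAddGroup.mk_surjective t
  induction t with
  | zero => rw [QuotientAddGroup.mk_zero, map_zero, map_zero]
  | tmul a m => exact h a m
  | add x y hx hy => rw [QuotientAddGroup.mk_add, map_add, map_add, hx, hy]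

end Tensor

/-- A left module is flat if and only if its character module is injective. -/
theorem isFlat_iff_injective_characterModule (M : Type u) [AddCommGroup M] [Module R M] :
    IsFlat R M ↔ Module.Injective Rᵐᵒᵖ (CharacterModule M) := by
  -- Both directions rest on $(A\otimes_RM)^+\cong\mathrm{Hom}(A,M^+)$; the converse also uses that
  -- characters separate points.
  refine ⟨fun h ↦ ⟨fun A B _ _ _ _ f hf g ↦ ?_⟩, fun h A B _ _ _ _ f hf ↦ ?_⟩
  · obtain ⟨c, hc⟩ := exists_character_extension _ (h f hf) (BalancedTensor.uncurry g)
    refine ⟨BalancedTensor.curry c, fun a ↦ CharacterModule.ext _ fun m ↦ ?_⟩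
    rw [BalancedTensor.curry_apply, ← BalancedTensor.map_mk, hc, BalancedTensor.uncurry_mk]
  · refine (injective_iff_map_eq_zero _).2 fun t ht ↦
      CharacterModule.eq_zero_of_character_apply fun c ↦ ?_
    obtain ⟨g, hg⟩ := h.out f hf (BalancedTensor.curry c)
    have : c = AddMonoidHom.comp (BalancedTensor.uncurry g) (BalancedTensor.map f M) :=
      BalancedTensor.character_ext fun a m ↦ by
        rw [← BalancedTensor.curry_apply, ← hg]; rfl
    rw [this]
    exact (congr(BalancedTensor.uncurry g $ht)).trans (map_zero _)

lemma injective_characterModule_of_projective (P : Type u) [AddCommGroup P] [Module R P]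
    [hP : Module.Projective R P] : Module.Injective Rᵐᵒᵖ (CharacterModule P) := by
  obtain ⟨s, hs⟩ := Module.projective_def.1 hP
  refine ⟨fun A B _ _ _ _ f hf g ↦ ?_⟩
  -- The extensions `h x` are only additive and depend arbitrarily on `x`. Weighting them by the
  -- coordinates of the linear section `s` gives an $R$-linear extension.
  have key (x : P) : ∃ h : CharacterModule B, ∀ a, h (f a) = g a x :=
    exists_character_extension f.toAddMonoidHom hf
      (AddMonoidHom.comp (AddMonoidHom.eval x) g.toAddMonoidHom)
  choose h hh using key
  refine ⟨{
    toFun b := ((Finsupp.liftAddHom fun x ↦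
      AddMonoidHom.comp (h x) ((AddMonoidHom.flip (smulAddHom Rᵐᵒᵖ B) b).comp
        MulOpposite.opAddEquiv.toAddMonoidHom)).comp s.toAddMonoidHom : P →+ AddCircle (1 : ℚ))
    map_add' b b' := ?_
    map_smul' r b := ?_ }, fun a ↦ ?_⟩
  · refine CharacterModule.ext _ fun p ↦ ?_
    change (s p).sum (fun x r ↦ h x (MulOpposite.op r • (b + b'))) =
      (s p).sum (fun x r ↦ h x (MulOpposite.op r • b)) +
        (s p).sum (fun x r ↦ h x (MulOpposite.op r • b'))
    simp only [smul_add, map_add]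
    exact Finsupp.sum_add
  · refine CharacterModule.ext _ fun p ↦ ?_
    change (s p).sum (fun x t ↦ h x (MulOpposite.op t • r • b)) =
      (s (r.unop • p)).sum (fun x t ↦ h x (MulOpposite.op t • b))
    rw [map_smul, Finsupp.sum_smul_index (by simp)]
    exact Finsupp.sum_congr fun x _ ↦ congr(h x $(smul_smul _ r b))
  · refine CharacterModule.ext _ fun p ↦ ?_
    change (s p).sum (fun x r ↦ h x (MulOpposite.op r • f a)) = g a p
    conv_rhs => rw [← hs p, Finsupp.linearCombination_apply, Finsupp.sum, map_sum]
    refine Finset.sum_congr rfl fun x _ ↦ ?_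
    dsimp only
    rw [← map_smul f, hh, map_smul g]
    rfl

end Character

/-! ### Extending maps into the character module of an injective module. -/

section CharacterOfInjective

variable {R : Type u} [Ring R]

lemma exists_comp_eq_of_surjective {M N Q : Type*} [AddCommGroup M] [AddCommGroup N]
    [AddCommGroup Q] [Module R M] [Module R N] [Module R Q] {θ : M →ₗ[R] N}
    (hθ : Function.Surjective θ) (φ : M →ₗ[R] Q) (h : LinearMap.ker θ ≤ LinearMap.ker φ) :
    ∃ ψ : N →ₗ[R] Q, ψ ∘ₗ θ = φ := by
  refine ⟨(LinearMap.ker θ).liftQ φ h ∘ₗ (θ.quotKerEquivOfSurjective hθ).symm.toLinearMap,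
    LinearMap.ext fun x ↦ ?_⟩
  have : (θ.quotKerEquivOfSurjective hθ).symm (θ x) = Submodule.Quotient.mk x := by
    rw [LinearEquiv.symm_apply_eq]; rfl
  simp [this]

/-- The map of left modules `I ^ k → I ^ m` defined by a matrix acting by scalars, as an additive
map. -/
def matrixMap (I : Type*) [AddCommGroup I] [Module R I] {k m : ℕ} (b : Fin k → Fin m → Rᵐᵒᵖ) :
    (Fin k → I) →ₗ[ℤ] (Fin m → I) :=
  AddMonoidHom.toIntLinearMap (AddMonoidHom.mk' (fun x j ↦ ∑ i, (b i j).unop • x i) fun x y ↦ by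
    ext j
    simp [Finset.sum_add_distrib])

lemma matrixMap_apply {I : Type*} [AddCommGroup I] [Module R I] {k m : ℕ}
    (b : Fin k → Fin m → Rᵐᵒᵖ) (x : Fin k → I) (j : Fin m) :
    matrixMap I b x j = ∑ i, (b i j).unop • x i := rfl

/-- The left linear map `R ^ k → R ^ l` defined by a matrix acting on the right. -/
def rightMatrixMap {k l : ℕ} (ρ : Fin l → Fin k → Rᵐᵒᵖ) : (Fin k → R) →ₗ[R] (Fin l → R) where
  toFun c t := ∑ i, ρ t i • c i
  map_add' c c' := by
    ext t
    simp [Finset.sum_add_distrib]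
  map_smul' a c := by
    ext t
    simp [Finset.mul_sum, mul_assoc]

lemma rightMatrixMap_apply {k l : ℕ} (ρ : Fin l → Fin k → Rᵐᵒᵖ) (c : Fin k → R) (t : Fin l) :
    rightMatrixMap ρ c t = ∑ i, ρ t i • c i := rfl

variable {I : Type u} [AddCommGroup I] [Module R I]

/-- A solution of a homogeneous system with coefficients generating `B` is a combination of
the relations between these generators, if maps from `B` to `R` extend. -/
lemma exists_eq_sum_smul_of_matrixMap_eq_zero (hI : Module.Baer R I) {m k l : ℕ}
    {B : Submodule Rᵐᵒᵖ (Fin m → Rᵐᵒᵖ)}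
    (hB : ∀ f : B →ₗ[Rᵐᵒᵖ] R, ∃ g : (Fin m → Rᵐᵒᵖ) →ₗ[Rᵐᵒᵖ] R, g ∘ₗ B.subtype = f)
    (b : Fin k → B) (hb : Function.Surjective (Fintype.linearCombination Rᵐᵒᵖ b))
    (ρ : Fin l → Fin k → Rᵐᵒᵖ)
    (hρ : LinearMap.ker (Fintype.linearCombination Rᵐᵒᵖ b) ≤
      Submodule.span Rᵐᵒᵖ (Set.range ρ))
    (x : Fin k → I) (hx : matrixMap I (fun i ↦ (b i : Fin m → Rᵐᵒᵖ)) x = 0) :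
    ∃ y : Fin l → I, ∀ i, x i = ∑ t, (ρ t i).unop • y t := by
  -- A vector `c` killed by all relations defines $f:B\to R$ with $f(b_i)=c_i$. An extension $g$ to
  -- the free module gives $c_i=\sum_j g(e_j)b_{ij}$, so $\sum_i c_ix_i=\sum_j g(e_j)\sum_i
  -- b_{ij}x_i=0$.
  have hker : LinearMap.ker (rightMatrixMap ρ) ≤ LinearMap.ker (Fintype.linearCombination R x) := by
    intro c hc
    obtain ⟨f, hf⟩ := exists_comp_eq_of_surjective hb (Fintype.linearCombination Rᵐᵒᵖ c)
      (hρ.trans (Submodule.span_le.2 (by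
        rintro _ ⟨t, rfl⟩
        exact congr($hc t))))
    have hf' (i : Fin k) : f (b i) = c i := by
      simpa using LinearMap.congr_fun hf (Pi.single i 1)
    obtain ⟨g, hg⟩ := hB f
    have hg' (i : Fin k) : c i = ∑ j, g (fun j' ↦ if j = j' then 1 else 0) *
        ((b i : Fin m → Rᵐᵒᵖ) j).unop := by
      rw [← hf', ← hg]
      exact LinearMap.pi_apply_eq_sum_univ g (b i : Fin m → Rᵐᵒᵖ)
    rw [LinearMap.mem_ker, Fintype.linearCombination_apply]
    simp_rw [hg', Finset.sum_smul, mul_smul]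
    rw [Finset.sum_comm]
    refine Finset.sum_eq_zero fun j _ ↦ ?_
    rw [← Finset.smul_sum, ← matrixMap_apply (fun i ↦ (b i : Fin m → Rᵐᵒᵖ)), hx, Pi.zero_apply,
      smul_zero]
  -- Injectivity of $I$ factors $c\mapsto\sum_i c_ix_i$ through $R^l$; the images of the basis
  -- vectors are the required `y`.
  obtain ⟨y, hy⟩ := exists_comp_eq_of_ker_le hI _ _ hker
  refine ⟨fun t ↦ y (fun t' ↦ if t = t' then 1 else 0), fun i ↦ ?_⟩
  have := LinearMap.congr_fun hy (Pi.single i 1)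
  rw [LinearMap.comp_apply, LinearMap.pi_apply_eq_sum_univ, Fintype.linearCombination_apply_single,
    one_smul] at this
  rw [← this]
  refine Finset.sum_congr rfl fun t _ ↦ ?_
  congr 1
  simp [rightMatrixMap_apply, Pi.single_apply]

/-- $F$ amounts to the character $\psi(x)=\sum_iF(b_i)(x_i)$ of $I^k$, and an extension to a
character $\Psi$ of $I^m$ with $\Psi\circ b=\psi$. Since $\mathbb Q/\mathbb Z$ is divisible, $\Psi$
exists once $\psi$ kills the kernel of $b$; elements of that kernel are combinations of relations
among the $b_i$, which the $F(b_i)$ also satisfy. -/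
lemma exists_extension_characterModule (hI : Module.Baer R I) [IsNoetherianRing Rᵐᵒᵖ] {m : ℕ}
    (B : Submodule Rᵐᵒᵖ (Fin m → Rᵐᵒᵖ))
    (hB : ∀ f : B →ₗ[Rᵐᵒᵖ] R, ∃ g : (Fin m → Rᵐᵒᵖ) →ₗ[Rᵐᵒᵖ] R, g ∘ₗ B.subtype = f)
    (F : B →ₗ[Rᵐᵒᵖ] CharacterModule I) :
    ∃ G : (Fin m → Rᵐᵒᵖ) →ₗ[Rᵐᵒᵖ] CharacterModule I, G ∘ₗ B.subtype = F := by
  obtain ⟨k, b, hb⟩ := Submodule.fg_iff_exists_fin_generating_family.1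
    (Module.Finite.fg_top (R := Rᵐᵒᵖ) (M := B))
  have hb' : Function.Surjective (Fintype.linearCombination Rᵐᵒᵖ b) := by
    rw [← LinearMap.range_eq_top, Fintype.range_linearCombination, hb]
  obtain ⟨l, ρ, hρ⟩ := Submodule.fg_iff_exists_fin_generating_family.1
    (IsNoetherian.noetherian (LinearMap.ker (Fintype.linearCombination Rᵐᵒᵖ b)))
  let ψ : (Fin k → I) →ₗ[ℤ] AddCircle (1 : ℚ) := AddMonoidHom.toIntLinearMap
    (AddMonoidHom.mk' (fun x ↦ ∑ i, F (b i) (x i)) fun x y ↦ by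
      simp [map_add, Finset.sum_add_distrib])
  have hψ : LinearMap.ker (matrixMap I fun i ↦ (b i : Fin m → Rᵐᵒᵖ)) ≤ LinearMap.ker ψ := by
    intro x hx
    obtain ⟨y, hy⟩ := exists_eq_sum_smul_of_matrixMap_eq_zero hI hB b hb' ρ hρ.ge x hx
    change ∑ i, F (b i) (x i) = 0
    simp_rw [hy, map_sum]
    rw [Finset.sum_comm]
    refine Finset.sum_eq_zero fun t _ ↦ ?_
    have h₁ : ∑ i, ρ t i • b i = 0 := by
      have : ρ t ∈ LinearMap.ker (Fintype.linearCombination Rᵐᵒᵖ b) :=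
        hρ ▸ Submodule.subset_span ⟨t, rfl⟩
      rwa [LinearMap.mem_ker, Fintype.linearCombination_apply] at this
    have h₂ : ∑ i, ρ t i • F (b i) = 0 := by
      simpa using congr(F $h₁)
    have h₃ : (∑ i, (ρ t i • F (b i) : CharacterModule I)) (y t) =
        ∑ i, (ρ t i • F (b i)) (y t) :=
      map_sum (AddMonoidHom.eval (y t)) (fun i ↦ ρ t i • F (b i)) Finset.univ
    rw [h₂] at h₃
    exact h₃.symm
  obtain ⟨Ψ, hΨ⟩ := exists_comp_eq_of_ker_le (Module.Baer.of_divisible _) _ _ hψ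
  let G : (Fin m → Rᵐᵒᵖ) →ₗ[Rᵐᵒᵖ] CharacterModule I :=
    { toFun y := AddMonoidHom.mk' (fun x ↦ Ψ fun j ↦ (y j).unop • x) fun x x' ↦ by
        rw [← map_add]
        congr 1
        ext j
        simp
      map_add' y y' := CharacterModule.ext _ fun x ↦ by
        refine Eq.trans ?_ (map_add Ψ _ _)
        refine congr(Ψ $(funext fun j ↦ ?_))
        simp [add_smul]
      map_smul' s y := CharacterModule.ext _ fun x ↦
        congr(Ψ $(funext fun j ↦ mul_smul (y j).unop s.unop x)) }
  refine ⟨G, LinearMap.ext_on_range hb fun i ↦ CharacterModule.ext _ fun x ↦ ?_⟩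
  have := LinearMap.congr_fun hΨ (Pi.single i x)
  rw [LinearMap.comp_apply] at this
  change Ψ (fun j ↦ ((b i : Fin m → Rᵐᵒᵖ) j).unop • x) = F (b i) x
  have h₁ : matrixMap I (fun i ↦ (b i : Fin m → Rᵐᵒᵖ)) (Pi.single i x) =
      fun j ↦ ((b i : Fin m → Rᵐᵒᵖ) j).unop • x := by
    ext j
    rw [matrixMap_apply, Finset.sum_eq_single i (fun i' _ h ↦ by simp [h]) (by simp)]
    simp
  have h₂ : ψ (Pi.single i x) = F (b i) x := by
    change ∑ i', F (b i') ((Pi.single i x : Fin k → I) i') = _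
    rw [Finset.sum_eq_single i (fun i' _ h ↦ by rw [Pi.single_eq_of_ne h, map_zero]) (by simp)]
    rw [Pi.single_eq_same]
  rw [← h₁, this, h₂]

end CharacterOfInjective

/-! ### Flatness of syzygies, read off from character modules. -/

section FlatDimension

variable {R : Type u} [Ring R]

lemma isNoetherianRing_mulOpposite (h : IsNoetherian Rᵐᵒᵖ R) : IsNoetherianRing Rᵐᵒᵖ :=
  isNoetherian_of_linearEquiv
    ({ MulOpposite.opAddEquiv with map_smul' := fun _ _ ↦ rfl } : R ≃ₗ[Rᵐᵒᵖ] Rᵐᵒᵖ)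

lemma hasInjectiveDimensionLE_characterModule {n : ℕ} (h : IsNoetherian Rᵐᵒᵖ R)
    (hn : HasInjectiveDimensionLE (ModuleCat.of Rᵐᵒᵖ R) n) (I : ModuleCat.{u} R) [Injective I] :
    HasInjectiveDimensionLE (ModuleCat.of Rᵐᵒᵖ (CharacterModule I)) n := by
  have := isNoetherianRing_mulOpposite h
  have : Module.Injective R I := Module.injective_module_of_injective_object R I
  refine hasInjectiveDimensionLE_of_subsingleton_ext_finite n fun A hA ↦
    subsingleton_ext_of_extension_property (Z := ModuleCat.of Rᵐᵒᵖ R)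
      (fun m B hB f ↦ exists_extension_characterModule (Module.Baer.of_injective this) B hB f) n A
      (HasInjectiveDimensionLT.subsingleton _ (n + 1) _ le_rfl _)

/-- The dual of a linear map, as a map of right modules between character modules. -/
def characterMap {M N : Type u} [AddCommGroup M] [Module R M] [AddCommGroup N] [Module R N]
    (f : M →ₗ[R] N) : CharacterModule N →ₗ[Rᵐᵒᵖ] CharacterModule M where
  toFun c := AddMonoidHom.comp c f.toAddMonoidHom
  map_add' _ _ := rfl
  map_smul' r c := CharacterModule.ext _ fun x ↦ congr(c $((f.map_smul r.unop x).symm))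

lemma shortExact_characterMap {S : ShortComplex (ModuleCat.{u} R)} (hS : S.ShortExact) :
    ∃ w, (ShortComplex.mk (ModuleCat.ofHom (characterMap S.g.hom))
      (ModuleCat.ofHom (characterMap S.f.hom)) w).ShortExact := by
  have hf : Function.Injective S.f.hom := hS.moduleCat_injective_f
  have hg : Function.Surjective S.g.hom := hS.moduleCat_surjective_g
  have hfg : Function.Exact S.f.hom S.g.hom :=
    (ShortComplex.ShortExact.moduleCat_exact_iff_function_exact _).1 hS.exact
  refine ⟨ModuleCat.hom_ext (LinearMap.ext fun c ↦ CharacterModule.ext _ fun x ↦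
    (congr(c $(hfg.apply_apply_eq_zero x))).trans (map_zero c)),
    ModuleCat.shortComplex_shortExact _ (fun c ↦ ⟨fun hc ↦ ?_, ?_⟩) (fun c c' h ↦ ?_) fun c ↦ ?_⟩
  · obtain ⟨c', hc'⟩ := exists_comp_eq_of_surjective (R := ℤ)
      (θ := S.g.hom.toAddMonoidHom.toIntLinearMap) hg (AddMonoidHom.toIntLinearMap c) fun x hx ↦ by
        obtain ⟨y, rfl⟩ := (hfg x).1 hx
        exact congr($hc y)
    exact ⟨c'.toAddMonoidHom, CharacterModule.ext _ fun x ↦ LinearMap.congr_fun hc' x⟩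
  · rintro ⟨c, rfl⟩
    exact CharacterModule.ext _ fun x ↦
      (congr(c $(hfg.apply_apply_eq_zero x))).trans (map_zero c)
  · refine CharacterModule.ext _ fun x ↦ ?_
    obtain ⟨x, rfl⟩ := hg x
    exact congr($h x)
  · obtain ⟨c', hc'⟩ := exists_character_extension S.f.hom.toAddMonoidHom hf c
    exact ⟨c', CharacterModule.ext _ hc'⟩

/-- Dualizing $0\to\Omega M\to P\to M\to 0$ makes $(\Omega M)^+$ a cosyzygy of $M^+$, as $P^+$ is
injective. -/
lemma hasInjectiveDimensionLE_characterModule_syz {M : ModuleCat.{u} R} {k : ℕ}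
    (h : HasInjectiveDimensionLE (ModuleCat.of Rᵐᵒᵖ (CharacterModule M)) (k + 1)) :
    HasInjectiveDimensionLE (ModuleCat.of Rᵐᵒᵖ (CharacterModule (syz M))) k := by
  obtain ⟨P, f, g, w, hS, hP⟩ := exists_shortExact_syz M
  obtain ⟨w', hS'⟩ := shortExact_characterMap hS
  have : Module.Projective R P := (IsProjective.iff_projective P).2 hP
  exact (hS'.hasInjectiveDimensionLT_X₃_iff k ((Module.injective_iff_injective_object _ _).1
    (injective_characterModule_of_projective P))).2 h

lemma isFlat_iff_hasInjectiveDimensionLE_zero (M : ModuleCat.{u} R) :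
    IsFlat R M ↔ HasInjectiveDimensionLE (ModuleCat.of Rᵐᵒᵖ (CharacterModule M)) 0 := by
  rw [isFlat_iff_injective_characterModule, Module.injective_iff_injective_object]
  exact injective_iff_hasInjectiveDimensionLT_one

lemma isFlat_syz {M : ModuleCat.{u} R} (h : IsFlat R M) : IsFlat R (syz M) := by
  rw [isFlat_iff_hasInjectiveDimensionLE_zero] at h ⊢
  exact hasInjectiveDimensionLE_characterModule_syz (hasInjectiveDimensionLT_of_ge _ 1 _ (by simp))

lemma isFlat_syz_iterate (k : ℕ) {M : ModuleCat.{u} R}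
    (h : HasInjectiveDimensionLE (ModuleCat.of Rᵐᵒᵖ (CharacterModule M)) k) :
    IsFlat R (syz^[k] M : ModuleCat.{u} R) := by
  induction k generalizing M with
  | zero => exact (isFlat_iff_hasInjectiveDimensionLE_zero M).2 h
  | succ k ih => exact ih (hasInjectiveDimensionLE_characterModule_syz h)

end FlatDimension

/-! ### Dimensions in `ℕ∞` versus explicit bounds. -/

section Dimension

lemma iInf_natCast_le_iff (p : ℕ → Prop) (n : ℕ) :
    ⨅ (k : ℕ) (_ : p k), (k : ℕ∞) ≤ n ↔ ∃ k ≤ n, p k := by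
  refine ⟨fun h ↦ ?_, fun ⟨k, hk, hp⟩ ↦ (iInf₂_le k hp).trans (by exact_mod_cast hk)⟩
  by_contra! hn
  have : ((n + 1 : ℕ) : ℕ∞) ≤ n :=
    (le_iInf₂ fun k hk ↦ by
      have : n < k := lt_of_not_ge fun hkn ↦ hn k hkn hk
      exact_mod_cast this).trans h
  norm_cast at this
  lia

variable {C : Type w} [Category.{v} C] [Abelian C]

lemma injDim_le_iff (M : C) (n : ℕ) : injDim M ≤ n ↔ HasInjectiveDimensionLE M n := by
  rw [injDim, iInf_natCast_le_iff]
  exact ⟨fun ⟨k, hk, h⟩ ↦ hasInjectiveDimensionLT_of_ge M (k + 1) _ (by lia), fun h ↦ ⟨n, le_rfl, h⟩⟩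

lemma resDim_le_iff (X : ObjectProperty C) (M : C) (n : ℕ) :
    resDim X M ≤ n ↔ ∃ k ≤ n, HasResolution X k M :=
  iInf_natCast_le_iff _ n

end Dimension

/-! ### Projective dimension of injectives, and the two inequalities. -/

section InjectiveModules

variable {R : Type u} [Ring R]

lemma hasInjectiveDimensionLE_of_syz {d e : ℕ}
    (hd : ∀ P : ModuleCat.{u} R, Projective P → HasInjectiveDimensionLE P d) (hde : d ≤ e)
    {M : ModuleCat.{u} R} (h : HasInjectiveDimensionLE (syz M) (e + 1)) :
    HasInjectiveDimensionLE M e := by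
  obtain ⟨P, f, g, w, hS, hP⟩ := exists_shortExact_syz M
  have := hd P hP
  exact hS.hasInjectiveDimensionLT_X₃ (e + 1)
    (hasInjectiveDimensionLT_of_ge P (d + 1) _ (by lia)) h

/-- The uniform bound `m` serves only to start the descent: applied to the flat module $\Omega F$, a
bound $d+e+1$ on all flats yields $d+e$ for $F$. -/
lemma hasInjectiveDimensionLE_of_isFlat {d m : ℕ}
    (hd : ∀ P : ModuleCat.{u} R, Projective P → HasInjectiveDimensionLE P d)
    (hm : ∀ F : ModuleCat.{u} R, IsFlat R F → HasInjectiveDimensionLE F m)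
    (F : ModuleCat.{u} R) (hF : IsFlat R F) : HasInjectiveDimensionLE F d := by
  have key (e : ℕ) : (∀ F : ModuleCat.{u} R, IsFlat R F → HasInjectiveDimensionLE F (d + e)) →
      ∀ F : ModuleCat.{u} R, IsFlat R F → HasInjectiveDimensionLE F d := by
    induction e with
    | zero => exact id
    | succ e ih =>
      exact fun h ↦ ih fun F hF ↦ hasInjectiveDimensionLE_of_syz hd (by lia) (h _ (isFlat_syz hF))
  refine key m (fun F hF ↦ ?_) F hF
  have := hm F hF
  exact hasInjectiveDimensionLT_of_ge F (m + 1) _ (by lia)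

lemma hasInjectiveDimensionLE_of_syz_iterate {d : ℕ}
    (hd : ∀ P : ModuleCat.{u} R, Projective P → HasInjectiveDimensionLE P d) (j : ℕ)
    {M : ModuleCat.{u} R} (h : HasInjectiveDimensionLE (syz^[j] M) d) :
    HasInjectiveDimensionLE M d := by
  induction j generalizing M with
  | zero => exact h
  | succ j ih =>
    have := ih h
    exact hasInjectiveDimensionLE_of_syz hd le_rfl (hasInjectiveDimensionLT_of_ge _ (d + 1) _ (by lia))

lemma hasProjectiveDimensionLE_of_syz_iterate (k : ℕ) {M : ModuleCat.{u} R}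
    (h : Projective (syz^[k] M)) : HasProjectiveDimensionLE M k := by
  induction k generalizing M with
  | zero => exact (projective_iff_hasProjectiveDimensionLE_zero _).1 h
  | succ k ih =>
    obtain ⟨P, f, g, w, hS, hP⟩ := exists_shortExact_syz M
    exact (hS.hasProjectiveDimensionLT_X₃_iff k hP).2 (ih h)

/-- The identity of $\Omega M$ extends to the projective cover term, so the presentation of $M$
splits. -/
lemma projective_of_subsingleton_ext_syz {M : ModuleCat.{u} R}
    (h : Subsingleton (Ext M (syz M) 1)) : Projective M := by
  obtain ⟨P, f, g, w, hS, hP⟩ := exists_shortExact_syz M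
  have := hS.epi_g
  obtain ⟨r, hr⟩ := exists_extension_of_subsingleton_ext hS h (𝟙 (syz M))
  let s := ShortComplex.Splitting.ofExactOfRetraction _ hS.exact r hr this
  have : Projective (ShortComplex.mk f g w).X₂ := hP
  exact Retract.projective { i := s.s, r := g, retract := s.s_g }

/-- If flat modules have injective dimension at most `d`, then a module whose character module
has finite injective dimension has projective dimension at most `d`. -/
lemma hasProjectiveDimensionLE_of_characterModule {d n : ℕ}
    (hd : ∀ F : ModuleCat.{u} R, IsFlat R F → HasInjectiveDimensionLE F d)
    (hP : ∀ P : ModuleCat.{u} R, Projective P → HasInjectiveDimensionLE P d)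
    {I : ModuleCat.{u} R}
    (hI : HasInjectiveDimensionLE (ModuleCat.of Rᵐᵒᵖ (CharacterModule I)) n) :
    HasProjectiveDimensionLE I d := by
  have hflat (j : ℕ) : IsFlat R (syz^[j] (syz^[n] I) : ModuleCat.{u} R) := by
    induction j with
    | zero => exact isFlat_syz_iterate n hI
    | succ j ih =>
      rw [Function.iterate_succ_apply']
      exact isFlat_syz ih
  -- $\Omega^{d+1}I$ need not be flat at this point, but its $n$-th syzygy is
  -- $\Omega^{d+1}\Omega^nI$, which is; the bound $d$ passes back from there.
  have h : HasInjectiveDimensionLE (syz^[d + 1] I) d := by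
    refine hasInjectiveDimensionLE_of_syz_iterate hP n ?_
    rw [← Function.iterate_add_apply, add_comm, Function.iterate_add_apply]
    exact hd _ (hflat (d + 1))
  rw [Function.iterate_succ_apply'] at h
  exact hasProjectiveDimensionLE_of_syz_iterate d (projective_of_subsingleton_ext_syz
    (subsingleton_ext_syz_iterate d 0 (HasInjectiveDimensionLT.subsingleton _ (d + 1) _ (by simp) _)))

lemma flatModules_self : flatModules R (ModuleCat.of R R) :=
  (isFlat_iff_injective_characterModule R).2 (injective_characterModule_of_projective R)

lemma globalDingProjDim_le {n d : ℕ} (hR : IsNGorenstein R n)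
    (hflat : injDimClass (flatModules R) < ⊤)
    (hd : HasInjectiveDimensionLE (ModuleCat.of R R) d) : globalDingProjDim R ≤ d := by
  have : IsNoetherianRing R := hR.left_noetherian
  obtain ⟨m, hm⟩ := ENat.ne_top_iff_exists.1 hflat.ne
  have hm' (F : ModuleCat.{u} R) (hF : IsFlat R F) : HasInjectiveDimensionLE F m :=
    (injDim_le_iff F m).1 ((le_iSup₂ (f := fun F (_ : flatModules R F) ↦ injDim F) F hF).trans hm.ge)
  have hP (P : ModuleCat.{u} R) (_ : Projective P) := hasInjectiveDimensionLE_of_projective hd P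
  have hF := hasInjectiveDimensionLE_of_isFlat hP hm'
  have hI (I : ModuleCat.{u} R) (_ : Injective I) :=
    hasProjectiveDimensionLE_of_characterModule hF hP (hasInjectiveDimensionLE_characterModule
      hR.right_noetherian ((injDim_le_iff _ n).1 hR.right_injDim) I)
  exact iSup_le fun M ↦ (resDim_le_iff _ M d).2 ⟨d, le_rfl, hasResolution_of_syz_iterate
    (fun P _ ↦ gorensteinProjective_of_projective) d (gorensteinProjective_syz_iterate hI hF M)⟩

lemma injDim_le_globalDingProjDim : injDim (ModuleCat.of R R) ≤ globalDingProjDim R := by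
  obtain h | h := eq_or_ne (globalDingProjDim R) ⊤
  · exact h ▸ le_top
  obtain ⟨e, he⟩ := ENat.ne_top_iff_exists.1 h
  rw [← he, injDim_le_iff, HasInjectiveDimensionLE, hasInjectiveDimensionLT_iff]
  intro i hi M x
  obtain ⟨k, hk, hM⟩ := (resDim_le_iff _ M e).1
    ((le_iSup (resDim (gorensteinProjective (isProjective _) (flatModules R))) M).trans he.ge)
  -- The resolution length `k` may depend on `M`, but $k\le e<i$ always holds.
  obtain ⟨j, rfl⟩ : ∃ j, i = j + k + 1 := ⟨i - k - 1, by lia⟩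
  have := subsingleton_ext_of_hasResolution
    (F := ModuleCat.of R R)
    (fun N hN ↦ subsingleton_ext_of_gorensteinProjective hN flatModules_self) hM j
  exact Subsingleton.elim _ _

end InjectiveModules

end DingDim

theorem proposition3p9 {R : Type u} [Ring R] (n : ℕ) (hR : DingDim.IsNGorenstein R n)
    (hflat : DingDim.injDimClass (DingDim.flatModules R) < ⊤) :
    DingDim.globalDingProjDim R ≤ n ∧
      DingDim.globalDingProjDim R = DingDim.injDim (ModuleCat.of R R) := by
  -- Working with the exact value $d=\mathrm{id}({}_RR)$ instead of $n$ yields both the bound and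
  -- the equality.
  obtain ⟨d, hd⟩ := ENat.ne_top_iff_exists.1
    (ne_top_of_le_ne_top (ENat.natCast_ne_top n) hR.left_injDim)
  have h := DingDim.globalDingProjDim_le hR hflat ((DingDim.injDim_le_iff _ d).1 hd.ge)
  exact ⟨h.trans (hd.le.trans hR.left_injDim),
    le_antisymm (h.trans hd.le) DingDim.injDim_le_globalDingProjDim⟩
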